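/- Let $R=\bigoplus_{\alpha\in\Gamma}R_\alpha$ be an integral domain graded by a commutative cancellative torsion-free (additive) monoid $\Gamma$, let $K$ be its quotient field, let $H$ be the set of nonzero homogeneous elements of $R$, and let $R_H\subseteq K$ be the homogeneous quotient field. Let $\star$ be a semistar operation on $R$, i.e. a map $E\mapsto E^\star$ on the nonzero $R$-submodules of $K$ such that, for all nonzero submodules $E,F$ and all $0\ne x\in K$: $(xE)^\star=xE^\star$; $E\subseteq F$ implies $E^\star\subseteq F^\star$; $E\subseteq E^\star$; and $(E^\star)^\star=E^\star$. Let $\widetilde\star$ be the semistar operation $$E^{\widetilde\star}=\{x\in K\mid xJ\subseteq E\text{ for some nonzero finitely generated ideal }J\subseteq R\text{ with }J^\star=R^\star\}.$$ A quasi-$\widetilde\star$-ideal is a nonzero ideal $I$ of $R$ with $I^{\widetilde\star}\cap R=I$; let $\mathcal M=h\text{-}\mathrm{QMax}^{\widetilde\star}(R)$ be the set of ideals that are maximal among the proper homogeneous quasi-$\widetilde\star$-ideals of $R$. For $f=\sum_i f_iX^i\in R[X]$ let $\mathcal A_f$ be the ideal of $R$ generated by the homogeneous components of all the coefficients $f_i$,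 let $N(\star)=\{f\in R[X]\mid f\neq 0,\ \mathcal A_f^\star=R^\star\}$ (a multiplicative set), and let $\mathrm{NA}(R,\star)=R[X]_{N(\star)}\subseteq K(X)$. For a domain $D\subseteq K$ let $D(X)=\{f/g\mid f,g\in D[X],\ g\text{ has unit content ideal}\}\subseteq K(X)$. Assume that $R^\star\subsetneq R_H$. Then every $Q\in\mathcal M$ is a prime ideal, and: 1. $N(\star)=R[X]\setminus\bigcup_{Q\in\mathcal M}Q[X]$. 2. The set of maximal ideals of $\mathrm{NA}(R,\star)$ is $\{Q\,\mathrm{NA}(R,\star)\mid Q\in\mathcal M\}$. 3. $\mathrm{NA}(R,\star)=\bigcap_{Q\in\mathcal M}R_Q(X)$. 4. For every nonzero $R$-submodule $I$ of $K$, $I\,\mathrm{NA}(R,\star)=\bigcap_{Q\in\mathcal M}I\,R_Q(X)$. 5. For every nonzero $R$-submodule $I$ of $K$, $I\,\mathrm{NA}(R,\star)\cap K=\bigcap_{Q\in\mathcal M}I\,R_Q$. 6. For every nonzero homogeneous ideal $I$ of $R$, and more generally for every nonzero $R$-submodule $I$ of $K$ such that $sI$ is a homogeneous ideal of $R$ for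 some $s\in H$, $I^{\widetilde\star}=I\,\mathrm{NA}(R,\star)\cap R_H$. -/

import Mathlib

open Polynomial Pointwise IsLocalization

noncomputable section

/-! ### Semistar operations -/

/-- A semistar operation on a domain `R` with quotient field `K`: a self-map `E ↦ E^⋆` of the set
of nonzero `R`-submodules of `K` which commutes with multiplication by nonzero elements of `K` and
is monotone, extensive and idempotent. The map is written as a function on all submodules; its value
at the zero submodule carries no information and is never used. -/
structure SemistarOperation (R K : Type*) [CommRing R] [Field K] [Algebra R K] where
  toFun : Submodule R K → Submodule R K
  map_smul : ∀ (x : K) (E : Submodule R K), x ≠ 0 → E ≠ ⊥ → toFun (x • E) = x • toFun E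
  mono : ∀ E F : Submodule R K, E ≠ ⊥ → E ≤ F → toFun E ≤ toFun F
  le_map : ∀ E : Submodule R K, E ≠ ⊥ → E ≤ toFun E
  idem : ∀ E : Submodule R K, E ≠ ⊥ → toFun (toFun E) = toFun E

namespace SemistarOperation

variable {R K : Type*} [CommRing R] [Field K] [Algebra R K]

instance : CoeFun (SemistarOperation R K) (fun _ => Submodule R K → Submodule R K) := ⟨toFun⟩

/-- If `E^⋆ = F^⋆ = R^⋆`, then `R^⋆ ⊆ (EF)^⋆`. -/
theorem one_le_mul (star : SemistarOperation R K) {E F : Submodule R K} (hE : E ≠ ⊥) (hF : F ≠ ⊥)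
    (hE1 : star E = star 1) (hF1 : star F = star 1) : star 1 ≤ star (E * F) := by
  have hEF : E * F ≠ ⊥ := by
    obtain ⟨x, hx, hx0⟩ := Submodule.exists_mem_ne_zero_of_ne_bot hE
    obtain ⟨y, hy, hy0⟩ := Submodule.exists_mem_ne_zero_of_ne_bot hF
    intro h
    have := Submodule.mul_mem_mul hx hy
    rw [h, Submodule.mem_bot] at this
    exact mul_ne_zero hx0 hy0 this
  have h10 : (1 : Submodule R K) ≠ ⊥ := one_ne_zero
  have h1 : (1 : K) ∈ star F := by
    rw [hF1]
    exact star.le_map 1 h10 (Submodule.one_le.1 le_rfl)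
  have key : E ≤ star (E * F) := by
    intro x hx
    by_cases hx0 : x = 0
    · simp [hx0]
    have hle : x • F ≤ E * F := by
      rintro _ ⟨y, hy, rfl⟩
      exact Submodule.mul_mem_mul hx hy
    have hne : x • F ≠ ⊥ := by
      obtain ⟨y, hy, hy0⟩ := Submodule.exists_mem_ne_zero_of_ne_bot hF
      intro h
      have : x • y ∈ x • F := Submodule.smul_mem_pointwise_smul y x F hy
      rw [h, Submodule.mem_bot, smul_eq_mul] at this
      exact mul_ne_zero hx0 hy0 this
    have h2 := star.mono _ _ hne hle
    rw [star.map_smul x F hx0 hF] at h2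
    have h3 := Submodule.smul_mem_pointwise_smul (1 : K) x _ h1
    simpa using h2 h3
  calc star 1 = star E := hE1.symm
    _ ≤ star (star (E * F)) := star.mono _ _ hE key
    _ = star (E * F) := star.idem _ hEF

theorem coe_le_one (J : Ideal R) : coeSubmodule K J ≤ 1 := by
  rw [← coeSubmodule_top (R := R) K]
  exact coeSubmodule_mono K le_top

/-- `J` is a nonzero finitely generated ideal of `R` with `J^⋆ = R^⋆`. -/
def IsFull (star : SemistarOperation R K) (J : Ideal R) : Prop :=
  J.FG ∧ J ≠ ⊥ ∧ star (coeSubmodule K J) = star 1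

theorem isFull_top [Nontrivial R] (star : SemistarOperation R K) : star.IsFull ⊤ :=
  ⟨⟨{1}, by simp⟩, top_ne_bot, by rw [coeSubmodule_top]⟩

variable [IsFractionRing R K]

theorem coe_ne_bot {J : Ideal R} (hJ : J ≠ ⊥) : coeSubmodule K J ≠ ⊥ := by
  intro h
  obtain ⟨x, hx, hx0⟩ := Submodule.exists_mem_ne_zero_of_ne_bot hJ
  have : algebraMap R K x ∈ coeSubmodule K J := (mem_coeSubmodule K J).2 ⟨x, hx, rfl⟩
  rw [h, Submodule.mem_bot] at this
  exact hx0 ((map_eq_zero_iff _ (IsFractionRing.injective R K)).1 this)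

theorem coe_eq_of_le (star : SemistarOperation R K) {I J : Ideal R} (hI : I ≠ ⊥) (hIJ : I ≤ J)
    (h : star 1 ≤ star (coeSubmodule K I)) : star (coeSubmodule K J) = star 1 := by
  have hJ : J ≠ ⊥ := ne_bot_of_le_ne_bot hI hIJ
  refine le_antisymm (star.mono _ _ (coe_ne_bot hJ) (coe_le_one J)) ?_
  exact h.trans (star.mono _ _ (coe_ne_bot hI) (coeSubmodule_mono K hIJ))

variable [IsDomain R]

theorem IsFull.mul {star : SemistarOperation R K} {I J : Ideal R} (hI : star.IsFull I)
    (hJ : star.IsFull J) : star.IsFull (I * J) := by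
  have h0 : I * J ≠ ⊥ := mul_ne_zero hI.2.1 hJ.2.1
  refine ⟨Submodule.FG.mul hI.1 hJ.1, h0, star.coe_eq_of_le h0 le_rfl ?_⟩
  rw [coeSubmodule_mul]
  exact star.one_le_mul (coe_ne_bot hI.2.1) (coe_ne_bot hJ.2.1) hI.2.2 hJ.2.2

theorem IsFull.pow {star : SemistarOperation R K} {I : Ideal R} (hI : star.IsFull I) (n : ℕ) :
    star.IsFull (I ^ n) := by
  induction n with
  | zero => simpa using star.isFull_top
  | succ n ih => rw [pow_succ]; exact ih.mul hI

/-- The submodule `{x ∈ K | xJ ⊆ E for some nonzero finitely generated ideal J ⊆ R with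
J^⋆ = R^⋆}`. -/
def tildeFun (star : SemistarOperation R K) (E : Submodule R K) : Submodule R K where
  carrier := {x | ∃ J : Ideal R, star.IsFull J ∧ ∀ a ∈ J, a • x ∈ E}
  zero_mem' := ⟨⊤, star.isFull_top, fun a _ => by simp⟩
  add_mem' := by
    rintro x y ⟨I, hI, hIx⟩ ⟨J, hJ, hJy⟩
    refine ⟨I * J, hI.mul hJ, fun a ha => ?_⟩
    have h₁ : I * J ≤ I := Ideal.mul_le_left
    have h₂ : I * J ≤ J := Ideal.mul_le_right
    rw [smul_add]
    exact E.add_mem (hIx a (h₁ ha)) (hJy a (h₂ ha))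
  smul_mem' := by
    rintro r x ⟨J, hJ, hJx⟩
    refine ⟨J, hJ, fun a ha => ?_⟩
    rw [smul_comm]
    exact E.smul_mem r (hJx a ha)

theorem le_tildeFun (star : SemistarOperation R K) (E : Submodule R K) : E ≤ star.tildeFun E :=
  fun _ hx => ⟨⊤, star.isFull_top, fun a _ => E.smul_mem a hx⟩

theorem tildeFun_mono (star : SemistarOperation R K) {E F : Submodule R K} (h : E ≤ F) :
    star.tildeFun E ≤ star.tildeFun F :=
  fun _ ⟨J, hJ, hJx⟩ => ⟨J, hJ, fun a ha => h (hJx a ha)⟩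

theorem exists_uniform (star : SemistarOperation R K) (E : Submodule R K) (x : K) (J : Ideal R)
    (hJ : J.FG) : (∀ a ∈ J, a • x ∈ star.tildeFun E) →
      ∃ I : Ideal R, star.IsFull I ∧ ∀ a ∈ J, ∀ b ∈ I, b • a • x ∈ E := by
  induction J, hJ using Submodule.fg_induction with
  | singleton y =>
    intro h
    obtain ⟨I, hI, hIy⟩ := h y (Submodule.mem_span_singleton_self y)
    refine ⟨I, hI, fun a ha b hb => ?_⟩
    obtain ⟨r, rfl⟩ := Submodule.mem_span_singleton.1 ha
    rw [smul_assoc, smul_comm]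
    exact E.smul_mem r (hIy b hb)
  | sup J₁ J₂ _ _ h₁ h₂ =>
    intro h
    obtain ⟨I₁, hI₁, hx₁⟩ := h₁ fun a ha => h a (Submodule.mem_sup_left ha)
    obtain ⟨I₂, hI₂, hx₂⟩ := h₂ fun a ha => h a (Submodule.mem_sup_right ha)
    refine ⟨I₁ * I₂, hI₁.mul hI₂, fun a ha b hb => ?_⟩
    obtain ⟨a₁, ha₁, a₂, ha₂, rfl⟩ := Submodule.mem_sup.1 ha
    have h₁ : I₁ * I₂ ≤ I₁ := Ideal.mul_le_left
    have h₂ : I₁ * I₂ ≤ I₂ := Ideal.mul_le_right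
    rw [add_smul, smul_add]
    exact E.add_mem (hx₁ a₁ ha₁ b (h₁ hb)) (hx₂ a₂ ha₂ b (h₂ hb))

/-- The semistar operation associated to `⋆`, stable and of finite type, sending `E` to
`{x ∈ K | xJ ⊆ E for some nonzero finitely generated ideal J ⊆ R with J^⋆ = R^⋆}`. -/
def tilde (star : SemistarOperation R K) : SemistarOperation R K where
  toFun := star.tildeFun
  map_smul := by
    intro x E hx _
    ext y
    rw [Submodule.mem_smul_pointwise_iff_exists]
    constructor
    · rintro ⟨J, hJ, hJy⟩
      refine ⟨x⁻¹ * y, ⟨J, hJ, fun a ha => ?_⟩, by simp [hx]⟩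
      obtain ⟨e, he, hey⟩ := (Submodule.mem_smul_pointwise_iff_exists _ _ _).1 (hJy a ha)
      rw [← mul_smul_comm, ← hey]
      simpa [hx] using he
    · rintro ⟨z, ⟨J, hJ, hJz⟩, rfl⟩
      refine ⟨J, hJ, fun a ha => ?_⟩
      rw [smul_comm]
      exact Submodule.smul_mem_pointwise_smul _ _ _ (hJz a ha)
  mono := fun _ _ _ h => star.tildeFun_mono h
  le_map := fun E _ => star.le_tildeFun E
  idem := by
    intro E _
    refine le_antisymm ?_ (star.le_tildeFun _)
    rintro x ⟨J, hJ, hJx⟩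
    obtain ⟨I, hI, hx⟩ := star.exists_uniform E x J hJ.1 hJx
    refine ⟨I * J, hI.mul hJ, fun c hc => ?_⟩
    refine Submodule.mul_induction_on hc (fun b hb a ha => ?_) (fun b c hb hc => ?_)
    · rw [mul_smul]
      exact hx a ha b hb
    · rw [add_smul]
      exact E.add_mem hb hc

/-- A quasi-`⋆`-ideal: a nonzero ideal `I` of `R` with `I^⋆ ∩ R = I`. -/
def IsQuasiIdeal (star : SemistarOperation R K) (I : Ideal R) : Prop :=
  I ≠ ⊥ ∧ (star (coeSubmodule K I)).comap (Algebra.linearMap R K) = I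

end SemistarOperation

/-! ### Rings of fractions inside a field -/

namespace GradedNagata

section Fractions

variable {A F : Type*} [CommRing A] [Field F]

/-- The ring of fractions `{a / s | a ∈ A, s ∈ S}` as a subring of the field `F`, where `A` is mapped
to `F` by `ρ`. It is used only when `ρ` is injective and `0 ∉ S`. -/
def fractions (ρ : A →+* F) (S : Submonoid A) : Subring F where
  carrier := {x | ∃ a : A, ∃ s ∈ S, ρ a / ρ s = x}
  zero_mem' := ⟨0, 1, S.one_mem, by simp⟩
  one_mem' := ⟨1, 1, S.one_mem, by simp⟩
  neg_mem' := by
    rintro _ ⟨a, s, hs, rfl⟩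
    exact ⟨-a, s, hs, by rw [map_neg, neg_div]⟩
  mul_mem' := by
    rintro _ _ ⟨a, s, hs, rfl⟩ ⟨b, t, ht, rfl⟩
    exact ⟨a * b, s * t, S.mul_mem hs ht, by rw [map_mul, map_mul, div_mul_div_comm]⟩
  add_mem' := by
    rintro _ _ ⟨a, s, hs, rfl⟩ ⟨b, t, ht, rfl⟩
    by_cases h : ρ s = 0
    · exact ⟨b, t, ht, by simp [h]⟩
    by_cases h' : ρ t = 0
    · exact ⟨a, s, hs, by simp [h']⟩
    exact ⟨a * t + s * b, s * t, S.mul_mem hs ht, by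
      rw [map_add, map_mul, map_mul, map_mul, div_add_div _ _ h h']⟩

/-- The canonical map `a ↦ a / 1` from `A` to a ring of fractions of `A`. -/
def toFractions (ρ : A →+* F) (S : Submonoid A) : A →+* fractions ρ S :=
  ρ.codRestrict _ fun a => ⟨a, 1, S.one_mem, by simp⟩

end Fractions

/-- The inclusion `D[X] → K(X)`, for a ring `D` mapped to the field `K`. -/
def polyToRatFunc (D K : Type*) [CommRing D] [Field K] [Algebra D K] : D[X] →+* RatFunc K :=
  (algebraMap K[X] (RatFunc K)).comp (mapRingHom (algebraMap D K))

/-- The polynomials over `D` whose coefficients generate the unit ideal. -/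
def unitContent (D : Type*) [CommRing D] : Submonoid D[X] where
  carrier := {g | g.contentIdeal = ⊤}
  one_mem' := contentIdeal_one
  mul_mem' := contentIdeal_mul_eq_top_of_contentIdeal_eq_top

section Local

variable {R : Type*} (K : Type*) [CommRing R] [Field K] [Algebra R K]

/-- The classical Nagata ring `D(X) = {f / g | f, g ∈ D[X], c(g) = D}` of a subring `D` of `K`. -/
def nagata (D : Subring K) : Subring (RatFunc K) :=
  fractions (polyToRatFunc D K) (unitContent D)

/-- The localization `R_Q` inside `K`. -/
def localRing (Q : Ideal R) (_ : Q.IsPrime) : Subring K :=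
  fractions (algebraMap R K) Q.primeCompl

variable {K}

/-- `I B`: the `B`-submodule of `F` generated by an `R`-submodule `I` of `K`, where `B` is a
subring of an extension field `F` of `K`. -/
def extend {F : Type*} [Field F] [Algebra K F] (B : Subring F) (I : Submodule R K) :
    Submodule B F :=
  Submodule.span B (algebraMap K F '' (I : Set K))

end Local

/-! ### Graded domains -/

section UniqueSums

/-- A torsion-free cancellative commutative monoid has unique sums. -/
theorem uniqueSums (Γ : Type*) [AddCancelCommMonoid Γ] [IsAddTorsionFree Γ] : TwoUniqueSums Γ :=
  .of_injective_addHom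
    ((DivisibleHull.coeAddMonoidHom (Algebra.GrothendieckAddGroup Γ)).comp
      (Algebra.GrothendieckAddGroup.of (M := Γ))).toAddHom
    (DivisibleHull.coe_injective.comp Algebra.GrothendieckAddGroup.of_injective) inferInstance

end UniqueSums

variable {Γ R : Type*} [AddCancelCommMonoid Γ] [DecidableEq Γ] [CommRing R]
  (𝒜 : Γ → AddSubgroup R) [GradedRing 𝒜]

/-- `C(a)`: the ideal generated by the homogeneous components of `a`. -/
def compIdeal (a : R) : Ideal R :=
  Ideal.span (Set.range fun γ : Γ => (DirectSum.decompose 𝒜 a γ : R))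

/-- The homogeneous content ideal `𝒜_f = ∑ᵢ C(fᵢ)` of a polynomial `f = ∑ᵢ fᵢ Xⁱ`. -/
def homContent (f : R[X]) : Ideal R := ⨆ i : ℕ, compIdeal 𝒜 (f.coeff i)

/-- The set `H` of nonzero homogeneous elements. -/
def nonzeroHomogeneous [IsDomain R] : Submonoid R where
  carrier := {a | a ≠ 0 ∧ SetLike.IsHomogeneousElem 𝒜 a}
  one_mem' := ⟨one_ne_zero, SetLike.isHomogeneousElem_one 𝒜⟩
  mul_mem' := fun ha hb => ⟨mul_ne_zero ha.1 hb.1, ha.2.mul hb.2⟩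

theorem mem_compIdeal (a : R) : a ∈ compIdeal 𝒜 a := by
  classical
  have h : ∑ γ ∈ (DirectSum.decompose 𝒜 a).support, (DirectSum.decompose 𝒜 a γ : R) ∈
      compIdeal 𝒜 a :=
    Submodule.sum_mem _ fun γ _ => Ideal.subset_span (Set.mem_range_self γ)
  rwa [DirectSum.sum_support_decompose 𝒜 a] at h

theorem compIdeal_le_iff {a : R} {P : Ideal R} :
    compIdeal 𝒜 a ≤ P ↔ ∀ γ, (DirectSum.decompose 𝒜 a γ : R) ∈ P := by
  rw [compIdeal, Ideal.span_le, Set.range_subset_iff]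
  rfl

theorem compIdeal_fg (a : R) : (compIdeal 𝒜 a).FG := by
  classical
  refine Submodule.fg_def.2 ⟨_, ?_, rfl⟩
  refine ((((DirectSum.decompose 𝒜 a).support.finite_toSet).image
    (fun γ => (DirectSum.decompose 𝒜 a γ : R))).insert 0).subset ?_
  rintro _ ⟨γ, rfl⟩
  by_cases h : DirectSum.decompose 𝒜 a γ = 0
  · left; simp [h]
  · right; exact ⟨γ, by simpa using h, rfl⟩

theorem homContent_fg (f : R[X]) : (homContent 𝒜 f).FG := by
  have : homContent 𝒜 f = ⨆ i ∈ f.support, compIdeal 𝒜 (f.coeff i) := by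
    refine le_antisymm (iSup_le fun i => ?_) (iSup₂_le fun i _ => le_iSup_of_le i le_rfl)
    by_cases h : i ∈ f.support
    · exact le_iSup₂_of_le i h le_rfl
    · rw [notMem_support_iff.1 h, compIdeal_le_iff]
      simp
  rw [this]
  exact Submodule.fg_biSup _ _ fun i _ => compIdeal_fg 𝒜 _

theorem homContent_ne_bot {f : R[X]} (hf : f ≠ 0) : homContent 𝒜 f ≠ ⊥ := by
  intro h
  apply hf
  ext i
  have : f.coeff i ∈ homContent 𝒜 f :=
    (le_iSup (fun i => compIdeal 𝒜 (f.coeff i)) i) (mem_compIdeal 𝒜 _)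
  simpa [h] using this

/-- The ring homomorphism `R → R[Γ]`, `a ↦ ∑ a_γ Y^γ`. -/
def coaction : R →+* AddMonoidAlgebra R Γ :=
  (DirectSum.toSemiring
    (fun γ => (AddMonoidAlgebra.singleAddHom γ).comp (AddSubgroup.subtype (𝒜 γ)))
    rfl
    (fun a b => by
      simp [AddMonoidAlgebra.single_mul_single])).comp
    (DirectSum.decomposeRingEquiv 𝒜).toRingHom

theorem coaction_coeff (a : R) (γ : Γ) :
    (coaction 𝒜 a).coeff γ = (DirectSum.decompose 𝒜 a γ : R) := by
  classical
  have h : coaction 𝒜 a = ∑ i ∈ (DirectSum.decompose 𝒜 a).support,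
      AddMonoidAlgebra.single i (DirectSum.decompose 𝒜 a i : R) := by
    change DirectSum.toAddMonoid _ (DirectSum.decompose 𝒜 a) = _
    conv_lhs => rw [← DirectSum.sum_support_of (DirectSum.decompose 𝒜 a)]
    rw [map_sum]
    refine Finset.sum_congr rfl fun i _ => ?_
    rw [DirectSum.toAddMonoid_of]
    rfl
  rw [h, AddMonoidAlgebra.coeff_sum, Finsupp.finsetSum_apply]
  simp only [AddMonoidAlgebra.coeff_single, Finsupp.single_apply, Finset.sum_ite_eq',
    DFinsupp.mem_support_toFun]
  split_ifs with h0
  · rfl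
  · simp [not_not.1 h0]

/-- `𝒜_f 𝒜_g` lies in the radical of `𝒜_{fg}`. -/
theorem homContent_mul_le_radical [IsAddTorsionFree Γ] (f g : R[X]) :
    homContent 𝒜 f * homContent 𝒜 g ≤ (homContent 𝒜 (f * g)).radical := by
  rw [Ideal.radical_eq_sInf, le_sInf_iff]
  rintro P ⟨hfg, hP⟩
  rw [hP.mul_le]
  have := uniqueSums Γ
  let φ : R →+* AddMonoidAlgebra (R ⧸ P) Γ :=
    (AddMonoidAlgebra.mapRingHom Γ (Ideal.Quotient.mk P)).comp (coaction 𝒜)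
  have hφ : ∀ a, φ a = 0 ↔ compIdeal 𝒜 a ≤ P := by
    intro a
    rw [compIdeal_le_iff, ← AddMonoidAlgebra.coeff_eq_zero, Finsupp.ext_iff]
    refine forall_congr' fun γ => ?_
    simp [φ, coaction_coeff, Ideal.Quotient.eq_zero_iff_mem]
  have key : ∀ h : R[X], h.map φ = 0 ↔ homContent 𝒜 h ≤ P := by
    intro h
    rw [homContent, iSup_le_iff, Polynomial.ext_iff]
    simp [hφ]
  rw [← key, ← key, ← mul_eq_zero, ← Polynomial.map_mul, key]
  exact hfg

variable {K : Type*} [Field K] [Algebra R K] [IsDomain R] [IsFractionRing R K]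

/-- `N(⋆) = {f ∈ R[X] | f ≠ 0, (𝒜_f)^⋆ = R^⋆}`, which is a multiplicative subset of `R[X]`. -/
def nStar [IsAddTorsionFree Γ] (star : SemistarOperation R K) : Submonoid R[X] where
  carrier := {f | f ≠ 0 ∧ star (coeSubmodule K (homContent 𝒜 f)) = star 1}
  one_mem' := by
    refine ⟨one_ne_zero, ?_⟩
    have : homContent 𝒜 (1 : R[X]) = ⊤ := by
      rw [Ideal.eq_top_iff_one]
      refine (le_iSup (fun i => compIdeal 𝒜 ((1 : R[X]).coeff i)) 0) ?_
      simpa using mem_compIdeal 𝒜 (1 : R)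
    rw [this, coeSubmodule_top]
  mul_mem' := by
    rintro f g ⟨hf0, hf⟩ ⟨hg0, hg⟩
    refine ⟨mul_ne_zero hf0 hg0, ?_⟩
    have hF : star.IsFull (homContent 𝒜 f) := ⟨homContent_fg 𝒜 f, homContent_ne_bot 𝒜 hf0, hf⟩
    have hG : star.IsFull (homContent 𝒜 g) := ⟨homContent_fg 𝒜 g, homContent_ne_bot 𝒜 hg0, hg⟩
    obtain ⟨n, hn⟩ := Ideal.exists_pow_le_of_le_radical_of_fg
      (homContent_mul_le_radical 𝒜 f g) (hF.mul hG).1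
    have hpow := (hF.mul hG).pow n
    exact star.coe_eq_of_le hpow.2.1 hn hpow.2.2.ge

/-- The Nagata ring `NA(R, ⋆) = R[X]_{N(⋆)}`, as a subring of `K(X)`. -/
def gradedNagata [IsAddTorsionFree Γ] (star : SemistarOperation R K) : Subring (RatFunc K) :=
  fractions (polyToRatFunc R K) (nStar 𝒜 star)

/-- The canonical map `R → NA(R, ⋆)`. -/
def toGradedNagata [IsAddTorsionFree Γ] (star : SemistarOperation R K) :
    R →+* gradedNagata 𝒜 star :=
  (toFractions (polyToRatFunc R K) (nStar 𝒜 star)).comp Polynomial.C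

variable (K) in
/-- The homogeneous quotient field `R_H`, as a subring of `K`. -/
def homogeneousQuotientField : Subring K :=
  fractions (algebraMap R K) (nonzeroHomogeneous 𝒜)

/-- The set of ideals that are maximal among the proper homogeneous quasi-`⋆`-ideals of `R`. -/
def hQMax (star : SemistarOperation R K) : Set (Ideal R) :=
  {Q | Maximal (fun I : Ideal R => I ≠ ⊤ ∧ I.IsHomogeneous 𝒜 ∧ star.IsQuasiIdeal I) Q}

/-- A homogeneous fractional ideal: an `R`-submodule `I` of `K` such that `sI` is a homogeneous
ideal of `R` for some nonzero homogeneous `s ∈ R`. Homogeneous ideals of `R` are the case `s = 1`. -/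
def IsHomogeneousFractional (I : Submodule R K) : Prop :=
  ∃ s ∈ nonzeroHomogeneous 𝒜, ∃ J : Ideal R, J.IsHomogeneous 𝒜 ∧
    algebraMap R K s • I = coeSubmodule K J

end GradedNagata

end

/-! ### Ideals containing no full ideal -/

/-! Call a nonzero finitely generated ideal `J` with `J^⋆ = R^⋆` full, and write `𝓜` for `hQMax 𝒜
star.tilde`. Full ideals are closed under products, so an ideal maximal among those containing none
is prime. A proper quasi-ideal for `star.tilde` contains no full ideal, and a nonzero prime
containing none is a quasi-ideal. Since `C(x)C(y)` lies in the radical of `C(xy)`, the homogeneous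
core of a prime is prime. With Zorn's lemma, the members of `𝓜` are therefore prime, and a
homogeneous ideal inside no `Q ∈ 𝓜` contains a full ideal (`exists_isFull_le`). Strictness of `R^⋆ ⊂
R_H` makes `𝓜` nonempty.

Applied to `𝒜_f`, this describes `N(⋆)`. Applied to the sum of the contents of all members of an
ideal of `R[X]`, it shows that an ideal disjoint from `N(⋆)` lies in some `Q[X]`
(`exists_le_map_C_of_disjoint`). Contractions of proper ideals then give the maximal ideals of the
Nagata ring. The ideals `{g | gu ∈ I[X]}` give the intersection formulas, once `R_Q(X)` is
identified with `R[X]` localized at `Q[X]`.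

For the last formula let `sI = J` and `x = a/t` with `t` homogeneous, so that `rx ∈ I` means `r·sa ∈
tJ`. The ideal of such `r` need not be homogeneous. A Dedekind–Mertens lemma
(`exists_compIdeal_pow_mul_le`) gives `C(r)^n C(sa) ⊆ tJ`; hence the homogeneous ideal `(tJ :
C(sa))` lies in no `Q` and contains a full ideal, which multiplies `x` into `I`. -/

namespace SemistarOperation

variable {R K : Type*} [CommRing R] [Field K] [Algebra R K]

/-- `I` contains no nonzero finitely generated ideal `J` with `J^⋆ = R^⋆`. -/
def ContainsNoFull (star : SemistarOperation R K) (I : Ideal R) : Prop :=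
  ∀ J : Ideal R, star.IsFull J → ¬ J ≤ I

theorem ContainsNoFull.ne_top [Nontrivial R] {star : SemistarOperation R K} {I : Ideal R}
    (h : star.ContainsNoFull I) : I ≠ ⊤ :=
  fun hI => h ⊤ star.isFull_top hI.ge

theorem ContainsNoFull.anti {star : SemistarOperation R K} {I J : Ideal R}
    (h : star.ContainsNoFull J) (hIJ : I ≤ J) : star.ContainsNoFull I :=
  fun L hL hLI => h L hL (hLI.trans hIJ)

/-- Zorn's lemma for ideals containing no full ideal, within a family of ideals closed under
suprema. -/
theorem ContainsNoFull.exists_le_maximal {star : SemistarOperation R K} (p : Ideal R → Prop)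
    (hp : ∀ c : Set (Ideal R), (∀ I ∈ c, p I) → p (sSup c)) {I : Ideal R} (hI : p I)
    (hfull : star.ContainsNoFull I) :
    ∃ M, I ≤ M ∧ Maximal (fun L => p L ∧ star.ContainsNoFull L) M := by
  refine zorn_le_nonempty₀ {L | p L ∧ star.ContainsNoFull L} (fun c hc hchain y hy =>
    ⟨sSup c, ⟨hp c fun L hL => (hc hL).1, fun J hJ hle => ?_⟩, fun z hz => le_sSup hz⟩)
    I ⟨hI, hfull⟩
  -- A full ideal is finitely generated, so one inside the union of a chain already lies in a
  -- member.
  have hcomp := (Submodule.fg_iff_compact J).1 hJ.1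
  rw [CompleteLattice.isCompactElement_iff_le_of_directed_sSup_le] at hcomp
  obtain ⟨L, hL, hJL⟩ := hcomp c ⟨y, hy⟩ hchain.directedOn hle
  exact (hc hL).2 J hJ hJL

theorem one_mem_map_one (star : SemistarOperation R K) : (1 : K) ∈ star 1 :=
  star.le_map 1 one_ne_zero (Submodule.one_le.1 le_rfl)

variable [IsFractionRing R K]

theorem isFull_of_le {star : SemistarOperation R K} {I J : Ideal R} (hJ : star.IsFull J)
    (hI : I.FG) (hJI : J ≤ I) : star.IsFull I :=
  ⟨hI, ne_bot_of_le_ne_bot hJ.2.1 hJI, star.coe_eq_of_le hJ.2.1 hJI hJ.2.2.ge⟩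

theorem smul_algebraMap_mem_coeSubmodule {I : Ideal R} {a x : R} :
    a • algebraMap R K x ∈ coeSubmodule K I ↔ a * x ∈ I := by
  rw [Algebra.smul_def, ← map_mul, mem_coeSubmodule]
  constructor
  · rintro ⟨y, hy, h⟩
    rwa [← IsFractionRing.injective R K h]
  · exact fun h => ⟨_, h, rfl⟩

variable [IsDomain R]

/-- Let `P` be maximal among the ideals containing no full ideal. If `x, y ∉ P`, then `P + (x)` and
`P + (y)` contain full ideals, whose product is full and lies in `P + (xy)`; so `xy ∉ P`. -/
theorem exists_prime_of_containsNoFull {star : SemistarOperation R K} {I : Ideal R}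
    (hI : star.ContainsNoFull I) : ∃ P : Ideal R, P.IsPrime ∧ I ≤ P ∧ star.ContainsNoFull P := by
  obtain ⟨P, hIP, hP⟩ := hI.exists_le_maximal (fun _ => True) (fun _ _ => trivial) trivial
  refine ⟨P, ⟨hP.prop.2.ne_top, fun {x y} hxy => ?_⟩, hIP, hP.prop.2⟩
  have key : ∀ z ∉ P, ∃ J, star.IsFull J ∧ J ≤ P ⊔ Ideal.span {z} := by
    intro z hz
    by_contra! h
    have hle := hP.le_of_ge ⟨trivial, fun J hJ => h J hJ⟩ le_sup_left
    exact hz (hle (Ideal.mem_sup_right (Ideal.mem_span_singleton_self z)))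
  by_contra! h
  obtain ⟨J₁, hJ₁, h₁⟩ := key x h.1
  obtain ⟨J₂, hJ₂, h₂⟩ := key y h.2
  refine hP.prop.2 _ (hJ₁.mul hJ₂) ((Ideal.mul_mono h₁ h₂).trans ?_)
  rw [Ideal.sup_mul, Ideal.mul_sup P, Ideal.mul_sup (Ideal.span {x}),
    Ideal.span_singleton_mul_span_singleton]
  exact sup_le (sup_le Ideal.mul_le_left Ideal.mul_le_left)
    (sup_le Ideal.mul_le_right ((Ideal.span_singleton_le_iff_mem P).2 hxy))

/-- If `xJ ⊆ P` with `J` full, any `a ∈ J` outside `P` forces `x ∈ P`. -/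
theorem isQuasiIdeal_of_isPrime {star : SemistarOperation R K} {P : Ideal R} (h0 : P ≠ ⊥)
    (hP : P.IsPrime) (hfull : star.ContainsNoFull P) : star.tilde.IsQuasiIdeal P := by
  refine ⟨h0, le_antisymm ?_ ?_⟩
  · rintro x ⟨J, hJ, hJx⟩
    obtain ⟨a, haJ, haP⟩ := Set.not_subset.1 (hfull J hJ)
    exact (hP.mem_or_mem (smul_algebraMap_mem_coeSubmodule.1 (hJx a haJ))).resolve_left haP
  · intro x hx
    exact star.le_tildeFun _ ((mem_coeSubmodule K P).2 ⟨x, hx, rfl⟩)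

/-- A full `J ⊆ I` would put `1` in the closure of `I`. With `isQuasiIdeal_of_isPrime`, this trades
the quasi-ideal condition for one that passes to unions of chains. -/
theorem IsQuasiIdeal.containsNoFull {star : SemistarOperation R K} {I : Ideal R}
    (hI : star.tilde.IsQuasiIdeal I) (h : I ≠ ⊤) : star.ContainsNoFull I := by
  intro J hJ hJI
  rw [Ne, Ideal.eq_top_iff_one] at h
  apply h
  have : (1 : R) ∈ (star.tilde (coeSubmodule K I)).comap (Algebra.linearMap R K) := by
    refine ⟨J, hJ, fun a ha => ?_⟩
    rw [Algebra.linearMap_apply, smul_algebraMap_mem_coeSubmodule, mul_one]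
    exact hJI ha
  rwa [hI.2] at this

end SemistarOperation

namespace GradedNagata

/-! ### Homogeneous ideals -/

section Homogeneous

variable {Γ R : Type*} [AddCancelCommMonoid Γ] [DecidableEq Γ] [CommRing R]
  (𝒜 : Γ → AddSubgroup R) [GradedRing 𝒜]

theorem compIdeal_isHomogeneous (a : R) : (compIdeal 𝒜 a).IsHomogeneous 𝒜 := by
  apply Ideal.homogeneous_span
  rintro _ ⟨γ, rfl⟩
  exact SetLike.isHomogeneousElem_coe _

theorem compIdeal_le_iff_mem {P : Ideal R} (hP : P.IsHomogeneous 𝒜) {a : R} :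
    compIdeal 𝒜 a ≤ P ↔ a ∈ P :=
  ⟨fun h => h (mem_compIdeal 𝒜 a), fun h => (compIdeal_le_iff 𝒜).2 fun γ => hP γ h⟩

theorem homContent_isHomogeneous (f : R[X]) : (homContent 𝒜 f).IsHomogeneous 𝒜 :=
  Ideal.IsHomogeneous.iSup fun _ => compIdeal_isHomogeneous 𝒜 _

theorem homContent_le_iff {P : Ideal R} (hP : P.IsHomogeneous 𝒜) {f : R[X]} :
    homContent 𝒜 f ≤ P ↔ f ∈ P.map C := by
  simp_rw [Ideal.mem_map_C_iff, homContent, iSup_le_iff, compIdeal_le_iff_mem 𝒜 hP]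

theorem mem_homogeneousCore_iff {P : Ideal R} {a : R} :
    a ∈ (P.homogeneousCore 𝒜).toIdeal ↔ compIdeal 𝒜 a ≤ P := by
  rw [← compIdeal_le_iff_mem 𝒜 (P.homogeneousCore 𝒜).isHomogeneous]
  refine ⟨fun h => h.trans (Ideal.toIdeal_homogeneousCore_le 𝒜 P), fun h => ?_⟩
  rw [compIdeal_le_iff]
  exact fun γ => Ideal.mem_homogeneousCore_of_homogeneous_of_mem (SetLike.isHomogeneousElem_coe _)
    ((compIdeal_le_iff 𝒜).1 h γ)

theorem homContent_C (a : R) : homContent 𝒜 (C a) = compIdeal 𝒜 a := by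
  refine le_antisymm (iSup_le fun i => ?_) ?_
  · rw [coeff_C]
    split_ifs
    · exact le_rfl
    · rw [compIdeal_le_iff]
      simp
  · exact le_iSup_of_le 0 (by rw [coeff_C_zero])

/-- Two members of an ideal of `R[X]` can be combined without loss of homogeneous content. -/
theorem exists_homContent_sup_le {𝔞 : Ideal R[X]} {f g : R[X]} (hf : f ∈ 𝔞) (hg : g ∈ 𝔞) :
    ∃ h ∈ 𝔞, homContent 𝒜 f ⊔ homContent 𝒜 g ≤ homContent 𝒜 h := by
  -- The shift by `f.natDegree + 1` keeps the coefficients of `f` and `g` from overlapping.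
  refine ⟨f + X ^ (f.natDegree + 1) * g, 𝔞.add_mem hf (𝔞.mul_mem_left _ hg),
    sup_le (iSup_le fun i => ?_) (iSup_le fun i => ?_)⟩
  · by_cases hi : i < f.natDegree + 1
    · refine le_iSup_of_le i ?_
      rw [coeff_add, coeff_X_pow_mul', if_neg (by omega), add_zero]
    · rw [coeff_eq_zero_of_natDegree_lt (by omega), compIdeal_le_iff]
      simp
  · refine le_iSup_of_le (i + (f.natDegree + 1)) ?_
    rw [coeff_add, coeff_X_pow_mul, coeff_eq_zero_of_natDegree_lt (p := f) (by omega), zero_add]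

/-- Constant polynomials in `homContent_mul_le_radical` give `C(x)C(y) ⊆ rad C(xy)`, and `rad C(xy)
⊆ P` if `xy` is in the core. -/
theorem isPrime_homogeneousCore [IsAddTorsionFree Γ] {P : Ideal R} (hP : P.IsPrime) :
    (P.homogeneousCore 𝒜).toIdeal.IsPrime := by
  refine ⟨ne_top_of_le_ne_top hP.ne_top (Ideal.toIdeal_homogeneousCore_le 𝒜 P), fun {x y} hxy => ?_⟩
  rw [mem_homogeneousCore_iff] at hxy ⊢
  rw [mem_homogeneousCore_iff, ← hP.mul_le]
  have h := homContent_mul_le_radical 𝒜 (C x) (C y)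
  rw [← C_mul, homContent_C, homContent_C, homContent_C] at h
  exact h.trans (hP.radical_le_iff.2 hxy)

/-- It suffices to test on homogeneous `y ∈ J`. By cancellation in `Γ`, `x_γ y` is the component of
`xy` in degree `γ + deg y`. -/
theorem isHomogeneous_colon {I J : Ideal R} (hI : I.IsHomogeneous 𝒜) (hJ : J.IsHomogeneous 𝒜) :
    (I.colon (J : Set R)).IsHomogeneous 𝒜 := by
  classical
  intro γ x hx
  rw [Submodule.mem_colon] at hx ⊢
  intro y hy
  rw [← DirectSum.sum_support_decompose 𝒜 y, Finset.smul_sum]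
  refine I.sum_mem fun δ _ => ?_
  have := hI (γ + δ) (hx _ (hJ δ hy))
  rwa [smul_eq_mul, DirectSum.coe_decompose_mul_add_of_right_mem 𝒜 (SetLike.coe_mem _)] at this

theorem sum_mul_sum_component {s t : Finset Γ} {a x : Γ → R} (ha : ∀ i, a i ∈ 𝒜 i)
    (hx : ∀ i, x i ∈ 𝒜 i) {γ δ : Γ} (hγ : γ ∈ s) (hδ : δ ∈ t) (hu : UniqueAdd s t γ δ) :
    (DirectSum.decompose 𝒜 ((∑ i ∈ s, a i) * ∑ j ∈ t, x j) (γ + δ) : R) = a γ * x δ := by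
  have hdeg : ∀ i j, a i * x j ∈ 𝒜 (i + j) := fun i j => SetLike.mul_mem_graded (ha i) (hx j)
  rw [Finset.sum_mul_sum, ← Finset.sum_product', DirectSum.decompose_sum, DFinsupp.finsetSum_apply,
    AddSubmonoidClass.coe_finsetSum, Finset.sum_eq_single (γ, δ)]
  · exact DirectSum.decompose_of_mem_same 𝒜 (hdeg γ δ)
  · rintro ⟨i, j⟩ hij hne
    rw [Finset.mem_product] at hij
    refine DirectSum.decompose_of_mem_ne 𝒜 (hdeg i j) fun h => hne ?_
    obtain ⟨rfl, rfl⟩ := hu hij.1 hij.2 h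
    rfl
  · exact fun h => (h (Finset.mk_mem_product hγ hδ)).elim

/-- A Dedekind–Mertens type lemma: if a product of two sums of homogeneous elements lies in a
homogeneous ideal, then so does the product of a power of the first content ideal with each
summand of the second factor. -/
theorem exists_span_pow_mul_le [UniqueSums Γ] (a x : Γ → R) (ha : ∀ i, a i ∈ 𝒜 i)
    (hx : ∀ i, x i ∈ 𝒜 i) (N : ℕ) : ∀ (s t : Finset Γ) (I : Ideal R), I.IsHomogeneous 𝒜 →
      s.card + t.card ≤ N → (∑ i ∈ s, a i) * ∑ j ∈ t, x j ∈ I →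
      ∃ n, Ideal.span (a '' s) ^ n * Ideal.span (x '' t) ≤ I := by
  have hspan : ∀ (y : Γ → R), (∀ i, y i ∈ 𝒜 i) → ∀ s : Set Γ,
      (Ideal.span (y '' s)).IsHomogeneous 𝒜 := by
    intro y hy s
    apply Ideal.homogeneous_span
    rintro _ ⟨i, _, rfl⟩
    exact ⟨i, hy i⟩
  have hcolon : ∀ I J L : Ideal R, L ≤ I.colon (J : Set R) ↔ J * L ≤ I := by
    intro I J L
    rw [mul_comm, Ideal.mul_le]
    exact forall₂_congr fun r _ => Submodule.mem_colon
  -- `I` stays universally quantified because both uses of the induction hypothesis replace it by a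
  -- colon ideal.
  induction N with
  | zero =>
    intro s t I _ hc _
    obtain rfl : s = ∅ := Finset.card_eq_zero.1 (by omega)
    exact ⟨1, by simp⟩
  | succ N ih =>
    intro s t I hI hc hmem
    rcases s.eq_empty_or_nonempty with rfl | hs
    · exact ⟨1, by simp⟩
    rcases t.eq_empty_or_nonempty with rfl | ht
    · exact ⟨1, by simp⟩
    obtain ⟨γ, hγ, δ, hδ, hu⟩ := UniqueSums.uniqueAdd_of_nonempty hs ht
    have hγδ : a γ * x δ ∈ I := by
      rw [← sum_mul_sum_component 𝒜 ha hx hγ hδ hu]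
      exact hI _ hmem
    have hs' : s.card = (s.erase γ).card + 1 := (Finset.card_erase_add_one hγ).symm
    have ht' : t.card = (t.erase δ).card + 1 := (Finset.card_erase_add_one hδ).symm
    have hsa := Finset.add_sum_erase s a hγ
    have htx := Finset.add_sum_erase t x hδ
    have hsingle : (Ideal.span {a γ}).IsHomogeneous 𝒜 := by
      simpa using hspan a ha {γ}
    -- Since `a γ * x δ ∈ I`, the summand `x δ` can be dropped after multiplication by `a γ`.
    obtain ⟨n, hn⟩ := ih s (t.erase δ) (I.colon (Ideal.span {a γ} : Ideal R))
      (isHomogeneous_colon 𝒜 hI hsingle) (by omega) (by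
        rw [Submodule.mem_colon_span_singleton, smul_eq_mul]
        have : (∑ i ∈ s, a i) * (∑ j ∈ t.erase δ, x j) * a γ =
            a γ * ((∑ i ∈ s, a i) * ∑ j ∈ t, x j) - (∑ i ∈ s, a i) * (a γ * x δ) := by
          rw [← htx]; ring
        rw [this]
        exact I.sub_mem (I.mul_mem_left _ hmem) (I.mul_mem_left _ hγδ))
    rw [hcolon] at hn
    have hsplit : ∀ (y : Γ → R) (u : Finset Γ) (i : Γ), i ∈ u →
        Ideal.span (y '' u) = Ideal.span {y i} ⊔ Ideal.span (y '' (u.erase i : Finset Γ)) := by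
      intro y u i hi
      rw [← Ideal.span_union, Set.singleton_union, ← Set.image_insert_eq, ← Finset.coe_insert,
        Finset.insert_erase hi]
    have h1 : Ideal.span {a γ} ≤ I.colon
        ((Ideal.span (a '' s) ^ n * Ideal.span (x '' t) : Ideal R) : Set R) := by
      rw [hcolon, mul_comm, hsplit x t δ hδ, Ideal.mul_sup, Ideal.mul_sup]
      refine sup_le ?_ hn
      rw [mul_left_comm, Ideal.span_singleton_mul_span_singleton]
      exact Ideal.mul_le_right.trans ((Ideal.span_singleton_le_iff_mem I).2 hγδ)
    have hpow : (Ideal.span (a '' s) ^ n).IsHomogeneous 𝒜 := by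
      clear hn h1
      induction n with
      | zero => simpa using Ideal.IsHomogeneous.top 𝒜
      | succ n ihn => rw [pow_succ]; exact ihn.mul (hspan a ha s)
    -- By `h1`, `a γ * ∑ x j` lies in the colon of `I` by the `n`-th power of the content, so modulo
    -- this colon the summand `a γ` can be dropped.
    obtain ⟨m, hm⟩ := ih (s.erase γ) t (I.colon ((Ideal.span (a '' s) ^ n : Ideal R) : Set R))
      (isHomogeneous_colon 𝒜 hI hpow) (by omega) (by
        have : (∑ i ∈ s.erase γ, a i) * (∑ j ∈ t, x j) =
            (∑ i ∈ s, a i) * (∑ j ∈ t, x j) - a γ * ∑ j ∈ t, x j := by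
          rw [← hsa]; ring
        rw [this]
        refine Ideal.sub_mem _ (Ideal.le_colon hmem) ?_
        rw [Submodule.mem_colon]
        intro y hy
        have h2 := Submodule.mem_colon.1 (h1 (Ideal.mem_span_singleton_self (a γ)))
          (y * ∑ j ∈ t, x j) (Ideal.mul_mem_mul hy (Ideal.sum_mem _ fun j hj =>
            Ideal.subset_span ⟨j, hj, rfl⟩))
        simp only [smul_eq_mul] at h2 ⊢
        convert h2 using 1
        ring)
    rw [hcolon] at hm
    rw [hcolon] at h1
    -- Of `1 + m` factors, either one is in `(a γ)`, which `h1` handles, or `m` lie in the ideal of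
    -- the remaining terms, which `hm` handles. Both use the other `n` factors.
    refine ⟨1 + m + n, ?_⟩
    have h3 : Ideal.span (a '' s) ^ (1 + m) ≤
        Ideal.span {a γ} ⊔ Ideal.span (a '' (s.erase γ : Finset Γ)) ^ m := by
      rw [hsplit a s γ hγ]
      simpa using Ideal.sup_pow_add_le_pow_sup_pow (I := Ideal.span {a γ})
        (J := Ideal.span (a '' (s.erase γ : Finset Γ))) (n := 1) (m := m)
    rw [pow_add _ (1 + m) n, mul_assoc]
    refine (Ideal.mul_mono_left h3).trans ?_
    rw [Ideal.sup_mul]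
    refine sup_le (by rwa [mul_comm]) (by rwa [mul_left_comm])

/-- If `a x` lies in a homogeneous ideal `I`, then `C(a)^n C(x) ⊆ I` for some `n`. -/
theorem exists_compIdeal_pow_mul_le [IsAddTorsionFree Γ] {I : Ideal R} (hI : I.IsHomogeneous 𝒜)
    {a x : R} (h : a * x ∈ I) : ∃ n, compIdeal 𝒜 a ^ n * compIdeal 𝒜 x ≤ I := by
  classical
  have := uniqueSums Γ
  have hspan : ∀ y : R, Ideal.span ((fun γ => (DirectSum.decompose 𝒜 y γ : R)) ''
      ((DirectSum.decompose 𝒜 y).support : Finset Γ)) = compIdeal 𝒜 y := by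
    intro y
    refine le_antisymm (Ideal.span_mono (Set.image_subset_range _ _)) ?_
    rw [compIdeal_le_iff]
    intro γ
    by_cases hγ : DirectSum.decompose 𝒜 y γ = 0
    · simp [hγ]
    · exact Ideal.subset_span ⟨γ, by simpa using hγ, rfl⟩
  obtain ⟨n, hn⟩ := exists_span_pow_mul_le 𝒜 (fun γ => (DirectSum.decompose 𝒜 a γ : R))
    (fun γ => (DirectSum.decompose 𝒜 x γ : R)) (fun _ => SetLike.coe_mem _)
    (fun _ => SetLike.coe_mem _) _ (DirectSum.decompose 𝒜 a).support
    (DirectSum.decompose 𝒜 x).support I hI le_rfl (by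
      rwa [DirectSum.sum_support_decompose, DirectSum.sum_support_decompose])
  rw [hspan, hspan] at hn
  exact ⟨n, hn⟩

end Homogeneous

end GradedNagata

namespace GradedNagata

/-! ### The maximal homogeneous quasi-ideals -/

section HQMax

open SemistarOperation

variable {Γ R K : Type*} [AddCancelCommMonoid Γ] [DecidableEq Γ]
  [CommRing R] [IsDomain R] [Field K] [Algebra R K] [IsFractionRing R K]
  (𝒜 : Γ → AddSubgroup R) [GradedRing 𝒜] {star : SemistarOperation R K}

theorem isHomogeneous_of_mem_hQMax {Q : Ideal R} (hQ : Q ∈ hQMax 𝒜 star.tilde) :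
    Q.IsHomogeneous 𝒜 := hQ.1.2.1

theorem containsNoFull_of_mem_hQMax {Q : Ideal R} (hQ : Q ∈ hQMax 𝒜 star.tilde) :
    star.ContainsNoFull Q := hQ.1.2.2.containsNoFull hQ.1.1

variable [IsAddTorsionFree Γ]

/-- A nonzero homogeneous ideal containing no full ideal lies in a prime ideal which is maximal
among the proper homogeneous quasi-ideals. -/
theorem exists_le_prime_mem_hQMax {I : Ideal R} (h0 : I ≠ ⊥) (hI : I.IsHomogeneous 𝒜)
    (hfull : star.ContainsNoFull I) : ∃ Q ∈ hQMax 𝒜 star.tilde, Q.IsPrime ∧ I ≤ Q := by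
  obtain ⟨Q, hIQ, hQ⟩ := hfull.exists_le_maximal (fun L => L.IsHomogeneous 𝒜)
    (fun c hc => Ideal.IsHomogeneous.sSup hc) hI
  obtain ⟨P, hP, hQP, hPfull⟩ := exists_prime_of_containsNoFull hQ.prop.2
  -- The core of `P` is homogeneous, contains `Q` and contains no full ideal, so maximality of `Q`
  -- gives equality.
  have hcore : (P.homogeneousCore 𝒜).toIdeal = Q := by
    have hle : Q ≤ (P.homogeneousCore 𝒜).toIdeal := fun x hx =>
      (mem_homogeneousCore_iff 𝒜).2 (((compIdeal_le_iff_mem 𝒜 hQ.prop.1).2 hx).trans hQP)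
    exact (hQ.le_of_ge ⟨(P.homogeneousCore 𝒜).isHomogeneous,
      hPfull.anti (Ideal.toIdeal_homogeneousCore_le 𝒜 P)⟩ hle).antisymm hle
  have hQprime : Q.IsPrime := hcore ▸ isPrime_homogeneousCore 𝒜 hP
  have hQ0 : Q ≠ ⊥ := ne_bot_of_le_ne_bot h0 hIQ
  refine ⟨Q, ⟨⟨hQprime.ne_top, hQ.prop.1, isQuasiIdeal_of_isPrime hQ0 hQprime hQ.prop.2⟩,
    fun L hL hQL => hQ.le_of_ge ⟨hL.2.1, hL.2.2.containsNoFull hL.1⟩ hQL⟩, hQprime, hIQ⟩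

theorem isPrime_of_mem_hQMax {Q : Ideal R} (hQ : Q ∈ hQMax 𝒜 star.tilde) : Q.IsPrime := by
  obtain ⟨P, hP, hPprime, hQP⟩ := exists_le_prime_mem_hQMax 𝒜 hQ.1.2.2.1
    (isHomogeneous_of_mem_hQMax 𝒜 hQ) (containsNoFull_of_mem_hQMax 𝒜 hQ)
  rwa [hQP.antisymm (hQ.2 hP.1 hQP)]

/-- Take `a/s ∈ R_H` outside `R^⋆`. A full ideal inside `sR` would give `1 ∈ sR^⋆`, hence `a/s ∈
R^⋆`. So `sR` contains none and lies in a member. -/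
theorem hQMax_nonempty
    (hstar : (star 1 : Set K) ⊂ (homogeneousQuotientField 𝒜 K : Set K)) :
    (hQMax 𝒜 star.tilde).Nonempty := by
  obtain ⟨_, ⟨a, s, hs, rfl⟩, hx⟩ := Set.exists_of_ssubset hstar
  have hs0 : algebraMap R K s ≠ 0 := by
    simpa using (map_ne_zero_iff _ (IsFractionRing.injective R K)).2 hs.1
  have hspan : coeSubmodule K (Ideal.span {s}) = algebraMap R K s • (1 : Submodule R K) := by
    rw [coeSubmodule_span_singleton]
    ext y
    rw [Submodule.mem_span_singleton, Submodule.mem_smul_pointwise_iff_exists]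
    simp only [Submodule.mem_one, Algebra.smul_def, exists_exists_eq_and, Algebra.algebraMap_self,
      RingHom.id_apply, mul_comm]
  obtain ⟨Q, hQ, -⟩ := exists_le_prime_mem_hQMax (star := star) 𝒜 (I := Ideal.span {s})
    (by simpa using hs.1) (Ideal.homogeneous_span 𝒜 _ (by simpa using hs.2)) (by
      intro J hJ hle
      apply hx
      have h1 : star 1 ≤ algebraMap R K s • star 1 := by
        rw [← star.map_smul _ _ hs0 one_ne_zero, ← hspan, ← hJ.2.2]
        exact star.mono _ _ (coe_ne_bot hJ.2.1) (coeSubmodule_mono K hle)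
      obtain ⟨y, hy, hys⟩ := (Submodule.mem_smul_pointwise_iff_exists _ _ _).1
        (h1 star.one_mem_map_one)
      have hy' : y = (algebraMap R K s)⁻¹ := eq_inv_of_mul_eq_one_right hys
      have := (star 1).smul_mem a hy
      rwa [Algebra.smul_def, hy', ← div_eq_mul_inv] at this)
  exact ⟨Q, hQ⟩

/-- An ideal which is homogeneous and lies in no member of `hQMax` contains a full ideal. -/
theorem exists_isFull_le (hne : (hQMax 𝒜 star.tilde).Nonempty) {I : Ideal R}
    (hI : I.IsHomogeneous 𝒜) (h : ∀ Q ∈ hQMax 𝒜 star.tilde, ¬ I ≤ Q) :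
    ∃ J, star.IsFull J ∧ J ≤ I := by
  by_contra! hfull
  obtain ⟨Q₀, hQ₀⟩ := hne
  have h0 : I ≠ ⊥ := by
    rintro rfl
    exact h Q₀ hQ₀ bot_le
  obtain ⟨Q, hQ, -, hIQ⟩ := exists_le_prime_mem_hQMax 𝒜 h0 hI hfull
  exact h Q hQ hIQ

/-! ### The multiplicative set -/

theorem isFull_homContent {f : R[X]} (hf : f ∈ nStar 𝒜 star) :
    star.IsFull (homContent 𝒜 f) :=
  ⟨homContent_fg 𝒜 f, homContent_ne_bot 𝒜 hf.1, hf.2⟩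

theorem mem_nStar_of_isFull_le {f : R[X]} {J : Ideal R} (hJ : star.IsFull J)
    (h : J ≤ homContent 𝒜 f) : f ∈ nStar 𝒜 star := by
  have hF := isFull_of_le hJ (homContent_fg 𝒜 f) h
  refine ⟨?_, hF.2.2⟩
  rintro rfl
  exact hF.2.1 (eq_bot_iff.2 ((homContent_le_iff 𝒜 (Ideal.IsHomogeneous.bot 𝒜)).2 (zero_mem _)))

theorem notMem_map_C_of_mem_nStar {f : R[X]} (hf : f ∈ nStar 𝒜 star) {Q : Ideal R}
    (hQ : Q ∈ hQMax 𝒜 star.tilde) : f ∉ Q.map C := by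
  rw [← homContent_le_iff 𝒜 (isHomogeneous_of_mem_hQMax 𝒜 hQ)]
  exact containsNoFull_of_mem_hQMax 𝒜 hQ _ (isFull_homContent 𝒜 hf)

theorem mem_nStar_iff (hne : (hQMax 𝒜 star.tilde).Nonempty) {f : R[X]} :
    f ∈ nStar 𝒜 star ↔ ∀ Q ∈ hQMax 𝒜 star.tilde, f ∉ Q.map C := by
  refine ⟨fun hf Q hQ => notMem_map_C_of_mem_nStar 𝒜 hf hQ, fun h => ?_⟩
  obtain ⟨J, hJ, hle⟩ := exists_isFull_le 𝒜 hne (homContent_isHomogeneous 𝒜 f) fun Q hQ => by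
    rw [homContent_le_iff 𝒜 (isHomogeneous_of_mem_hQMax 𝒜 hQ)]
    exact h Q hQ
  exact mem_nStar_of_isFull_le 𝒜 hJ hle

/-- An ideal of `R[X]` which is disjoint from `N(⋆)` lies in `Q[X]` for some `Q`. -/
theorem exists_le_map_C_of_disjoint (hne : (hQMax 𝒜 star.tilde).Nonempty) {𝔞 : Ideal R[X]}
    (h : ∀ f ∈ 𝔞, f ∉ nStar 𝒜 star) : ∃ Q ∈ hQMax 𝒜 star.tilde, 𝔞 ≤ Q.map C := by
  by_contra! hQ
  obtain ⟨J, hJ, hle⟩ := exists_isFull_le 𝒜 (star := star) hne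
    (I := ⨆ f : 𝔞, homContent 𝒜 (f : R[X]))
    (Ideal.IsHomogeneous.iSup fun f => homContent_isHomogeneous 𝒜 _) fun Q hQM hle =>
      hQ Q hQM fun f hf => (homContent_le_iff 𝒜 (isHomogeneous_of_mem_hQMax 𝒜 hQM)).1
        ((le_iSup (fun f : 𝔞 => homContent 𝒜 (f : R[X])) ⟨f, hf⟩).trans hle)
  -- By directedness, the finitely generated `J` lies in the content of a single `f ∈ 𝔞`, which
  -- forces `f ∈ N(⋆)`.
  have hdir : Directed (· ≤ ·) fun f : 𝔞 => homContent 𝒜 (f : R[X]) := by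
    rintro ⟨f, hf⟩ ⟨g, hg⟩
    obtain ⟨k, hk, hle⟩ := exists_homContent_sup_le 𝒜 hf hg
    exact ⟨⟨k, hk⟩, le_sup_left.trans hle, le_sup_right.trans hle⟩
  have hcomp := (Submodule.fg_iff_compact J).1 hJ.1
  rw [CompleteLattice.isCompactElement_iff_le_of_directed_sSup_le] at hcomp
  obtain ⟨_, ⟨f, rfl⟩, hf⟩ := hcomp _ (Set.range_nonempty _) hdir.directedOn_range hle
  exact h f f.2 (mem_nStar_of_isFull_le 𝒜 hJ hf)

end HQMax

end GradedNagata

namespace GradedNagata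

/-! ### Rings of fractions and extensions of submodules -/

section Fractions

variable {A F : Type*} [CommRing A] [Field F] {ρ : A →+* F} {S : Submonoid A}

theorem isLocalization_fractions (hρ : Function.Injective ρ) (hS : (0 : A) ∉ S) :
    letI := (toFractions ρ S).toAlgebra
    IsLocalization S (fractions ρ S) := by
  let _ := (toFractions ρ S).toAlgebra
  have hne : ∀ s ∈ S, ρ s ≠ 0 := fun s hs h => hS ((map_eq_zero_iff ρ hρ).1 h ▸ hs)
  have hval : ∀ a : A, ((algebraMap A (fractions ρ S) a : fractions ρ S) : F) = ρ a := fun _ => rfl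
  refine ⟨fun s => ?_, ?_, fun {x y} h => ⟨1, ?_⟩⟩
  · rw [isUnit_iff_exists_inv]
    refine ⟨⟨(ρ s)⁻¹, 1, s, s.2, by simp⟩, Subtype.ext ?_⟩
    exact mul_inv_cancel₀ (hne s s.2)
  · rintro ⟨_, a, s, hs, rfl⟩
    refine ⟨(a, ⟨s, hs⟩), Subtype.ext ?_⟩
    exact div_mul_cancel₀ _ (hne s hs)
  · rw [hρ (show ρ x = ρ y from congrArg Subtype.val h)]

theorem map_mem_fractions (a : A) : ρ a ∈ fractions ρ S := ⟨a, 1, S.one_mem, by simp⟩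

end Fractions

section Extend

variable {R K : Type*} [CommRing R] [Field K] [Algebra R K]

/-- The case `I = R` lets the formula for the Nagata ring follow from that for extended submodules.
-/
theorem mem_extend_one {F : Type*} [Field F] [Algebra K F] {B : Subring F}
    (hB : ∀ r : R, algebraMap K F (algebraMap R K r) ∈ B) {u : F} :
    u ∈ extend B (1 : Submodule R K) ↔ u ∈ B := by
  constructor
  · intro hu
    induction hu using Submodule.span_induction with
    | mem x hx =>
      obtain ⟨y, hy, rfl⟩ := hx
      obtain ⟨r, rfl⟩ := Submodule.mem_one.1 hy
      exact hB r
    | zero => exact B.zero_mem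
    | add x y _ _ hx hy => exact B.add_mem hx hy
    | smul b x _ hx => exact B.mul_mem b.2 hx
  · intro hu
    have h1 : (1 : F) ∈ extend B (1 : Submodule R K) :=
      Submodule.subset_span ⟨1, Submodule.one_le.1 le_rfl, map_one _⟩
    simpa [Subring.smul_def] using (extend B (1 : Submodule R K)).smul_mem ⟨u, hu⟩ h1

theorem smul_mem_smul_iff {c : K} (hc : c ≠ 0) {I : Submodule R K} {x : K} :
    c • x ∈ c • I ↔ x ∈ I := by
  rw [Submodule.mem_smul_pointwise_iff_exists]
  refine ⟨?_, fun h => ⟨x, h, rfl⟩⟩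
  rintro ⟨y, hy, h⟩
  rwa [← smul_right_injective K hc h]

theorem coeff_map_mul_mem {I : Submodule R K} {p : K[X]} (hp : ∀ i, p.coeff i ∈ I) (f : R[X])
    (i : ℕ) : (f.map (algebraMap R K) * p).coeff i ∈ I := by
  rw [coeff_mul]
  refine I.sum_mem fun x _ => ?_
  rw [coeff_map, ← Algebra.smul_def]
  exact I.smul_mem _ (hp _)

theorem polyToRatFunc_apply (f : R[X]) :
    polyToRatFunc R K f = algebraMap K[X] (RatFunc K) (f.map (algebraMap R K)) := rfl

theorem polyToRatFunc_C (r : R) :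
    polyToRatFunc R K (C r) = algebraMap K (RatFunc K) (algebraMap R K r) := by
  rw [polyToRatFunc_apply, map_C, ← Polynomial.algebraMap_eq, ← IsScalarTower.algebraMap_apply]

theorem polyToRatFunc_injective [FaithfulSMul R K] : Function.Injective (polyToRatFunc R K) :=
  (RatFunc.algebraMap_injective K).comp (map_injective _ (FaithfulSMul.algebraMap_injective R K))

theorem polyToRatFunc_ne_zero [FaithfulSMul R K] {S : Submonoid R[X]} (hS : (0 : R[X]) ∉ S)
    {g : R[X]} (hg : g ∈ S) : polyToRatFunc R K g ≠ 0 := fun h =>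
  hS ((map_eq_zero_iff _ polyToRatFunc_injective).1 h ▸ hg)

/-- The ideal of the polynomials over `R` which multiply `u ∈ K(X)` into `I[X]`. -/
def polyColon (I : Submodule R K) (u : RatFunc K) : Ideal R[X] where
  carrier := {g | ∃ p : K[X], (∀ i, p.coeff i ∈ I) ∧
    polyToRatFunc R K g * u = algebraMap K[X] (RatFunc K) p}
  zero_mem' := ⟨0, by simp, by simp⟩
  add_mem' := by
    rintro g h ⟨p, hp, hgp⟩ ⟨q, hq, hhq⟩
    exact ⟨p + q, fun i => by rw [coeff_add]; exact I.add_mem (hp i) (hq i), by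
      rw [map_add, map_add, add_mul, hgp, hhq]⟩
  smul_mem' := by
    rintro f g ⟨p, hp, hgp⟩
    exact ⟨f.map (algebraMap R K) * p, coeff_map_mul_mem hp f, by
      rw [smul_eq_mul, map_mul, map_mul, mul_assoc, hgp, polyToRatFunc_apply]⟩

/-- Common denominators turn membership into the question whether an ideal of `R[X]` meets `S`, the
form to which `exists_le_map_C_of_disjoint` applies. -/
theorem mem_extend_fractions_iff [FaithfulSMul R K] {S : Submonoid R[X]} (hS : (0 : R[X]) ∉ S)
    {I : Submodule R K} {u : RatFunc K} :
    u ∈ extend (fractions (polyToRatFunc R K) S) I ↔ ∃ g ∈ S, g ∈ polyColon I u := by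
  constructor
  · intro hu
    induction hu using Submodule.span_induction with
    | mem x hx =>
      obtain ⟨y, hy, rfl⟩ := hx
      refine ⟨1, S.one_mem, C y, fun i => ?_, ?_⟩
      · rw [coeff_C]
        split_ifs
        exacts [hy, I.zero_mem]
      · rw [map_one, one_mul, ← Polynomial.algebraMap_eq, ← IsScalarTower.algebraMap_apply]
    | zero => exact ⟨1, S.one_mem, 0, by simp, by simp⟩
    | add x y _ _ hx hy =>
      obtain ⟨g, hg, p, hp, hgp⟩ := hx
      obtain ⟨h, hh, q, hq, hhq⟩ := hy
      refine ⟨g * h, S.mul_mem hg hh, h.map (algebraMap R K) * p + g.map (algebraMap R K) * q,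
        fun i => ?_, ?_⟩
      · rw [coeff_add]
        exact I.add_mem (coeff_map_mul_mem hp h i) (coeff_map_mul_mem hq g i)
      · rw [map_add, map_mul, map_mul, map_mul, ← hgp, ← hhq, ← polyToRatFunc_apply,
          ← polyToRatFunc_apply]
        ring
    | smul b x _ hx =>
      obtain ⟨g, hg, p, hp, hgp⟩ := hx
      obtain ⟨_, f, h, hh, rfl⟩ := b
      refine ⟨h * g, S.mul_mem hh hg, f.map (algebraMap R K) * p, coeff_map_mul_mem hp f, ?_⟩
      have h0 := polyToRatFunc_ne_zero (K := K) hS hh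
      rw [Subring.smul_def, smul_eq_mul, map_mul, map_mul, ← hgp, ← polyToRatFunc_apply]
      field_simp
  · rintro ⟨g, hg, p, hp, hgp⟩
    have h0 := polyToRatFunc_ne_zero (K := K) hS hg
    have hu : u = ∑ i ∈ p.support, (⟨polyToRatFunc R K (X ^ i) / polyToRatFunc R K g, X ^ i, g, hg,
        rfl⟩ : fractions (polyToRatFunc R K) S) • algebraMap K (RatFunc K) (p.coeff i) := by
      rw [← mul_right_inj' h0, hgp]
      conv_lhs => rw [p.as_sum_support_C_mul_X_pow]
      rw [map_sum, Finset.mul_sum]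
      refine Finset.sum_congr rfl fun i _ => ?_
      change _ = _ * (polyToRatFunc R K (X ^ i) / polyToRatFunc R K g * _)
      rw [polyToRatFunc_apply (X ^ i), Polynomial.map_pow, map_X, map_mul, ← Polynomial.algebraMap_eq, ← IsScalarTower.algebraMap_apply]
      field_simp
    rw [hu]
    exact Submodule.sum_mem _ fun i _ =>
      Submodule.smul_mem _ _ (Submodule.subset_span ⟨_, hp i, rfl⟩)

theorem mem_extend_localRing_iff [FaithfulSMul R K] {Q : Ideal R} (hQ : Q.IsPrime)
    {I : Submodule R K} {x : K} :
    x ∈ extend (localRing K Q hQ) I ↔ ∃ s ∉ Q, s • x ∈ I := by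
  have hne : ∀ s ∉ Q, algebraMap R K s ≠ 0 := fun s hs h =>
    hs ((map_eq_zero_iff _ (FaithfulSMul.algebraMap_injective R K)).1 h ▸ Q.zero_mem)
  constructor
  · intro hx
    induction hx using Submodule.span_induction with
    | mem x hx =>
      obtain ⟨y, hy, rfl⟩ := hx
      exact ⟨1, fun h => hQ.ne_top ((Ideal.eq_top_iff_one Q).2 h), by simpa using hy⟩
    | zero => exact ⟨1, fun h => hQ.ne_top ((Ideal.eq_top_iff_one Q).2 h), by simp⟩
    | add x y _ _ hx hy =>
      obtain ⟨s, hs, hsx⟩ := hx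
      obtain ⟨t, ht, hty⟩ := hy
      refine ⟨s * t, fun h => (hQ.mem_or_mem h).elim hs ht, ?_⟩
      rw [smul_add]
      refine I.add_mem ?_ ?_
      · rw [mul_comm, mul_smul]
        exact I.smul_mem _ hsx
      · rw [mul_smul]
        exact I.smul_mem _ hty
    | smul b x _ hx =>
      obtain ⟨s, hs, hsx⟩ := hx
      obtain ⟨_, a, t, ht, rfl⟩ := b
      refine ⟨t * s, fun h => (hQ.mem_or_mem h).elim ht hs, ?_⟩
      have h0 := hne t ht
      convert I.smul_mem a hsx using 1
      rw [Subring.smul_def, smul_eq_mul]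
      simp only [Algebra.smul_def, map_mul]
      field_simp
  · rintro ⟨s, hs, hsx⟩
    have h0 := hne s hs
    have h : x = (⟨algebraMap R K 1 / algebraMap R K s, 1, s, hs, rfl⟩ : localRing K Q hQ) •
        algebraMap K K (s • x) := by
      change x = algebraMap R K 1 / algebraMap R K s * (s • x)
      rw [Algebra.smul_def, map_one]
      field_simp
    rw [h]
    exact Submodule.smul_mem _ _ (Submodule.subset_span ⟨_, hsx, rfl⟩)

end Extend

/-! ### Localizations at primes and their Nagata rings -/

section Nagata

variable {R K : Type*} [CommRing R] [Field K] [Algebra R K] [FaithfulSMul R K]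

/-- Over the local ring `R_Q`, unit content means that some coefficient is a unit; for a polynomial
over `R` this says that it lies outside `Q[X]`. Clearing denominators does the rest. -/
theorem nagata_localRing {Q : Ideal R} (hQ : Q.IsPrime) :
    nagata K (localRing K Q hQ) =
      fractions (polyToRatFunc R K) (Q.map C : Ideal R[X]).primeCompl := by
  have h0 : (0 : R) ∉ Q.primeCompl := fun h => h Q.zero_mem
  let _ : Algebra R (localRing K Q hQ) := (toFractions (algebraMap R K) Q.primeCompl).toAlgebra
  have hloc : IsLocalization Q.primeCompl (localRing K Q hQ) :=
    isLocalization_fractions (FaithfulSMul.algebraMap_injective R K) h0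
  have hmap : ∀ f : R[X], polyToRatFunc (localRing K Q hQ) K
      (f.map (algebraMap R (localRing K Q hQ))) = polyToRatFunc R K f := by
    intro f
    rw [polyToRatFunc_apply, polyToRatFunc_apply, Polynomial.map_map]
    rfl
  have hunit : ∀ s ∈ Q.primeCompl, IsUnit (algebraMap R (localRing K Q hQ) s) := fun s hs =>
    IsLocalization.map_units (localRing K Q hQ) (⟨s, hs⟩ : Q.primeCompl)
  have hC : ∀ s ∈ Q.primeCompl, (C s : R[X]) ∉ Q.map C := fun s hs h =>
    hs (by simpa using Ideal.mem_map_C_iff.1 h 0)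
  ext u
  constructor
  · rintro ⟨f, g, hg, rfl⟩
    obtain ⟨b, hb, hf'⟩ := integerNormalization_spec Q.primeCompl f
    obtain ⟨c, hc, hg'⟩ := integerNormalization_spec Q.primeCompl g
    set f' := integerNormalization Q.primeCompl f
    set g' := integerNormalization Q.primeCompl g
    have hgQ : g' ∉ Q.map C := by
      intro hmem
      have hle : g.contentIdeal ≤ Q.map (algebraMap R (localRing K Q hQ)) := by
        rw [contentIdeal_def, Ideal.span_le]
        intro x hx
        obtain ⟨i, -, rfl⟩ := mem_coeffs_iff.1 hx
        have h1 := Ideal.mem_map_of_mem (algebraMap R (localRing K Q hQ))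
          (Ideal.mem_map_C_iff.1 hmem i)
        rw [← coeff_map, hg', coeff_smul, Algebra.smul_def] at h1
        exact (Ideal.unit_mul_mem_iff_mem _ (hunit c hc)).1 h1
      have hprime := IsLocalization.isPrime_of_isPrime_disjoint Q.primeCompl (localRing K Q hQ) Q hQ
        (Set.disjoint_left.2 fun _ h h' => h h')
      exact hprime.ne_top (top_le_iff.1 (hg.ge.trans hle))
    -- From `f' = b f` and `g' = c g` follows `f / g = c f' / (b g')`.
    refine ⟨C c * f', C b * g', (Ideal.primeCompl _).mul_mem (hC b hb) hgQ, ?_⟩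
    have hfrac : ∀ (r : R) (p : (localRing K Q hQ)[X]), polyToRatFunc (localRing K Q hQ) K (r • p) =
        polyToRatFunc R K (C r) * polyToRatFunc (localRing K Q hQ) K p := by
      intro r p
      rw [← hmap, ← map_mul, map_C, ← algebraMap_smul (localRing K Q hQ) r p, smul_eq_C_mul]
    have hne : ∀ s ∈ Q.primeCompl, polyToRatFunc R K (C s) ≠ 0 := fun s hs h =>
      hC s hs ((map_eq_zero_iff _ polyToRatFunc_injective).1 h ▸ zero_mem _)
    rw [map_mul, map_mul, ← hmap f', ← hmap g', hf', hg', hfrac, hfrac]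
    have hb0 := hne b hb
    have hc0 := hne c hc
    rw [← mul_assoc, ← mul_assoc, mul_comm (polyToRatFunc R K (C b)),
      mul_div_mul_left _ _ (mul_ne_zero hc0 hb0)]
  · rintro ⟨f, g, hg, rfl⟩
    refine ⟨f.map (algebraMap R (localRing K Q hQ)), g.map (algebraMap R (localRing K Q hQ)),
      ?_, by rw [hmap, hmap]⟩
    obtain ⟨i, hi⟩ := not_forall.1 (Ideal.mem_map_C_iff.not.1 hg)
    exact Ideal.eq_top_of_isUnit_mem _ (coeff_map (algebraMap R (localRing K Q hQ)) i ▸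
      coeff_mem_contentIdeal _ i) (hunit _ hi)

theorem mem_extend_nagata_iff {Q : Ideal R} (hQ : Q.IsPrime) {I : Submodule R K} {u : RatFunc K} :
    u ∈ extend (nagata K (localRing K Q hQ)) I ↔ ∃ g ∉ Q.map C, g ∈ polyColon I u := by
  rw [nagata_localRing hQ, mem_extend_fractions_iff fun h : (0 : R[X]) ∉ Q.map C => h (zero_mem _)]
  rfl

/-- For constant `x`, `gx ∈ I[X]` can be read coefficient by coefficient, and some coefficient of
`g` is outside `Q`. -/
theorem algebraMap_mem_extend_nagata_iff {Q : Ideal R} (hQ : Q.IsPrime) {I : Submodule R K}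
    {x : K} : algebraMap K (RatFunc K) x ∈ extend (nagata K (localRing K Q hQ)) I ↔
      x ∈ extend (localRing K Q hQ) I := by
  rw [mem_extend_nagata_iff, mem_extend_localRing_iff]
  constructor
  · rintro ⟨g, hg, p, hp, hgp⟩
    rw [Ideal.mem_map_C_iff, not_forall] at hg
    obtain ⟨i, hi⟩ := hg
    refine ⟨g.coeff i, hi, ?_⟩
    rw [polyToRatFunc_apply, IsScalarTower.algebraMap_apply K K[X] (RatFunc K), ← map_mul] at hgp
    have := hp i
    rwa [← RatFunc.algebraMap_injective K hgp, Polynomial.algebraMap_eq, coeff_mul_C, coeff_map,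
      ← Algebra.smul_def] at this
  · rintro ⟨s, hs, hsx⟩
    refine ⟨C s, fun h => hs ?_, C (s • x), fun i => ?_, ?_⟩
    · simpa using Ideal.mem_map_C_iff.1 h 0
    · rw [coeff_C]
      split_ifs
      exacts [hsx, I.zero_mem]
    · rw [polyToRatFunc_C, ← map_mul, Algebra.smul_def,
        IsScalarTower.algebraMap_apply K K[X] (RatFunc K), Polynomial.algebraMap_eq]

end Nagata

end GradedNagata

namespace GradedNagata

section Main

open SemistarOperation

variable {Γ R K : Type*} [AddCancelCommMonoid Γ] [IsAddTorsionFree Γ] [DecidableEq Γ]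
  [CommRing R] [IsDomain R] [Field K] [Algebra R K] [IsFractionRing R K]
  (𝒜 : Γ → AddSubgroup R) [GradedRing 𝒜] {star : SemistarOperation R K}

theorem zero_notMem_nStar : (0 : R[X]) ∉ nStar 𝒜 star := fun h => h.1 rfl

/-! ### The maximal ideals of the Nagata ring -/

/-- The canonical map `R[X] → NA(R, ⋆)`. -/
noncomputable def polyToGradedNagata (star : SemistarOperation R K) : R[X] →+* gradedNagata 𝒜 star :=
  toFractions (polyToRatFunc R K) (nStar 𝒜 star)

theorem isLocalization_gradedNagata (star : SemistarOperation R K) :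
    letI := (polyToGradedNagata 𝒜 star).toAlgebra
    IsLocalization (nStar 𝒜 star) (gradedNagata 𝒜 star) :=
  isLocalization_fractions polyToRatFunc_injective (zero_notMem_nStar 𝒜)

theorem map_toGradedNagata (Q : Ideal R) :
    Q.map (toGradedNagata 𝒜 star) =
      (Q.map C).map (polyToGradedNagata 𝒜 star) :=
  (Ideal.map_map _ _).symm

theorem comap_map_toGradedNagata {Q : Ideal R} (hQ : Q ∈ hQMax 𝒜 star.tilde) :
    (Q.map (toGradedNagata 𝒜 star)).comap (polyToGradedNagata 𝒜 star) =
      Q.map C := by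
  let _ := (polyToGradedNagata 𝒜 star).toAlgebra
  have hloc := isLocalization_gradedNagata 𝒜 star
  have := isPrime_of_mem_hQMax 𝒜 hQ
  rw [map_toGradedNagata]
  exact IsLocalization.under_map_of_isPrime_disjoint (nStar 𝒜 star)
    (gradedNagata 𝒜 star) inferInstance
    (Set.disjoint_left.2 fun f hf => notMem_map_C_of_mem_nStar 𝒜 hf hQ)

/-- A proper ideal contracts to an ideal of `R[X]` disjoint from `N(⋆)`, and an ideal of a
localization is the extension of its contraction. -/
theorem exists_le_map_toGradedNagata (hne : (hQMax 𝒜 star.tilde).Nonempty)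
    {M : Ideal (gradedNagata 𝒜 star)} (hM : M ≠ ⊤) :
    ∃ Q ∈ hQMax 𝒜 star.tilde, M ≤ Q.map (toGradedNagata 𝒜 star) := by
  let _ := (polyToGradedNagata 𝒜 star).toAlgebra
  have hloc := isLocalization_gradedNagata 𝒜 star
  obtain ⟨Q, hQ, hle⟩ := exists_le_map_C_of_disjoint 𝒜 (star := star) hne
    (𝔞 := M.comap (polyToGradedNagata 𝒜 star)) fun f hf hfN =>
      hM (Ideal.eq_top_of_isUnit_mem M hf (IsLocalization.map_units (gradedNagata 𝒜 star) (⟨f, hfN⟩ : nStar 𝒜 star)))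
  refine ⟨Q, hQ, ?_⟩
  rw [map_toGradedNagata]
  exact (IsLocalization.map_under (nStar 𝒜 star) _ M).ge.trans (Ideal.map_mono hle)

theorem isMaximal_iff (hne : (hQMax 𝒜 star.tilde).Nonempty) (M : Ideal (gradedNagata 𝒜 star)) :
    M.IsMaximal ↔ ∃ Q ∈ hQMax 𝒜 star.tilde, M = Q.map (toGradedNagata 𝒜 star) := by
  have hne_top : ∀ Q ∈ hQMax 𝒜 star.tilde, Q.map (toGradedNagata 𝒜 star) ≠ ⊤ := by
    intro Q hQ htop
    have := comap_map_toGradedNagata 𝒜 hQ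
    rw [htop, Ideal.comap_top, eq_comm, Ideal.eq_top_iff_one] at this
    exact notMem_map_C_of_mem_nStar 𝒜 (nStar 𝒜 star).one_mem hQ this
  constructor
  · intro hM
    obtain ⟨Q, hQ, hle⟩ := exists_le_map_toGradedNagata 𝒜 hne hM.ne_top
    exact ⟨Q, hQ, hM.eq_of_le (hne_top Q hQ) hle⟩
  · rintro ⟨Q, hQ, rfl⟩
    -- A maximal ideal above the extension of `Q` lies in the extension of some `Q'`. Contracting
    -- gives `Q ⊆ Q'`, and maximality of `Q` in `hQMax` makes them equal.
    obtain ⟨M, hM, hQM⟩ := Ideal.exists_le_maximal _ (hne_top Q hQ)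
    obtain ⟨Q', hQ', hle⟩ := exists_le_map_toGradedNagata 𝒜 hne hM.ne_top
    have hQQ' : Q ≤ Q' := by
      have h := Ideal.comap_mono (f := polyToGradedNagata 𝒜 star)
        (hQM.trans hle)
      rw [comap_map_toGradedNagata 𝒜 hQ, comap_map_toGradedNagata 𝒜 hQ'] at h
      intro x hx
      simpa using Ideal.mem_map_C_iff.1 (h (Ideal.mem_map_of_mem C hx)) 0
    obtain rfl : Q = Q' := hQQ'.antisymm (hQ.2 hQ'.1 hQQ')
    rwa [hQM.antisymm hle]

/-! ### Extensions to the Nagata ring as intersections -/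

/-- If `polyColon I u` missed `N(⋆)`, it would lie in some `Q[X]`, against membership at that `Q`.
-/
theorem mem_extend_gradedNagata_iff (hne : (hQMax 𝒜 star.tilde).Nonempty) {I : Submodule R K}
    {u : RatFunc K} : u ∈ extend (gradedNagata 𝒜 star) I ↔
      ∀ (Q : Ideal R) (hQ : Q ∈ hQMax 𝒜 star.tilde),
        u ∈ extend (nagata K (localRing K Q (isPrime_of_mem_hQMax 𝒜 hQ))) I := by
  rw [gradedNagata, mem_extend_fractions_iff (zero_notMem_nStar 𝒜)]
  simp_rw [mem_extend_nagata_iff]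
  constructor
  · rintro ⟨g, hg, hgu⟩ Q hQ
    exact ⟨g, notMem_map_C_of_mem_nStar 𝒜 hg hQ, hgu⟩
  · intro h
    by_contra! hdisj
    obtain ⟨Q, hQ, hle⟩ := exists_le_map_C_of_disjoint 𝒜 (star := star) hne
      (𝔞 := polyColon I u) fun f hf hfN => hdisj f hfN hf
    obtain ⟨g, hg, hgu⟩ := h Q hQ
    exact hg (hle hgu)

theorem mem_gradedNagata_iff (hne : (hQMax 𝒜 star.tilde).Nonempty) {u : RatFunc K} :
    u ∈ gradedNagata 𝒜 star ↔ ∀ (Q : Ideal R) (hQ : Q ∈ hQMax 𝒜 star.tilde),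
      u ∈ nagata K (localRing K Q (isPrime_of_mem_hQMax 𝒜 hQ)) := by
  have hmem : ∀ (S : Submonoid R[X]) (r : R), algebraMap K (RatFunc K) (algebraMap R K r) ∈
      fractions (polyToRatFunc R K) S := fun S r => polyToRatFunc_C (K := K) r ▸ map_mem_fractions _
  rw [← mem_extend_one (R := R) (K := K) (B := gradedNagata 𝒜 star) (hmem _),
    mem_extend_gradedNagata_iff 𝒜 hne]
  refine forall₂_congr fun Q hQ => mem_extend_one fun r => ?_
  rw [nagata_localRing]
  exact hmem _ r

theorem algebraMap_mem_extend_gradedNagata_iff (hne : (hQMax 𝒜 star.tilde).Nonempty)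
    {I : Submodule R K} {x : K} :
    algebraMap K (RatFunc K) x ∈ extend (gradedNagata 𝒜 star) I ↔
      ∀ (Q : Ideal R) (hQ : Q ∈ hQMax 𝒜 star.tilde),
        x ∈ extend (localRing K Q (isPrime_of_mem_hQMax 𝒜 hQ)) I := by
  simp_rw [mem_extend_gradedNagata_iff 𝒜 hne, algebraMap_mem_extend_nagata_iff]

/-! ### Homogeneous fractional ideals -/

/-- From `sxL ⊆ J ⊆ R` with `L` full follows `sxR^⋆ = (sxL)^⋆ ⊆ R^⋆`. As `R^⋆ ⊆ R_H`, this puts `x`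
in `R_H` when `s` is homogeneous. -/
theorem algebraMap_smul_mem_of_mem_tilde {I : Submodule R K} {s : R} {J : Ideal R}
    (hJ : algebraMap R K s • I = coeSubmodule K J) {x : K} (hx : x ∈ star.tilde I) :
    s • x ∈ star 1 := by
  obtain ⟨L, hL, hLx⟩ := hx
  by_cases hx0 : s • x = 0
  · rw [hx0]
    exact zero_mem _
  have hle : (s • x) • coeSubmodule K L ≤ 1 := by
    rintro _ ⟨_, hy, rfl⟩
    obtain ⟨a, ha, rfl⟩ := (mem_coeSubmodule K L).1 hy
    refine coe_le_one J ?_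
    rw [← hJ]
    convert Submodule.smul_mem_pointwise_smul _ (algebraMap R K s) _ (hLx a ha) using 1
    simp [Algebra.smul_def]
    ring
  have hne : (s • x) • coeSubmodule K L ≠ ⊥ := by
    rw [Submodule.ne_bot_iff]
    obtain ⟨y, hy, hy0⟩ := Submodule.exists_mem_ne_zero_of_ne_bot (coe_ne_bot (K := K) hL.2.1)
    exact ⟨_, Submodule.smul_mem_pointwise_smul y (s • x) _ hy, mul_ne_zero hx0 hy0⟩
  have h := star.mono _ _ hne hle
  rw [star.map_smul _ _ hx0 (coe_ne_bot hL.2.1), hL.2.2] at h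
  simpa using h (Submodule.smul_mem_pointwise_smul 1 (s • x) _ star.one_mem_map_one)

theorem mem_tilde_iff_of_isHomogeneousFractional
    (hstar : (star 1 : Set K) ⊂ (homogeneousQuotientField 𝒜 K : Set K)) {I : Submodule R K}
    (hI : IsHomogeneousFractional 𝒜 I) {x : K} :
    x ∈ star.tilde I ↔ algebraMap K (RatFunc K) x ∈ extend (gradedNagata 𝒜 star) I ∧
      x ∈ homogeneousQuotientField 𝒜 K := by
  have hinj := IsFractionRing.injective R K
  have hne := hQMax_nonempty 𝒜 hstar
  obtain ⟨s, hs, J, hJ, hsI⟩ := hI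
  have hs0 : algebraMap R K s ≠ 0 := (map_ne_zero_iff _ hinj).2 hs.1
  rw [algebraMap_mem_extend_gradedNagata_iff 𝒜 hne]
  simp_rw [mem_extend_localRing_iff]
  constructor
  · intro hx
    constructor
    · intro Q hQ
      obtain ⟨L, hL, hLx⟩ := hx
      obtain ⟨a, haL, haQ⟩ := Set.not_subset.1 (containsNoFull_of_mem_hQMax 𝒜 hQ L hL)
      exact ⟨a, haQ, hLx a haL⟩
    · have h1 := hstar.1 (algebraMap_smul_mem_of_mem_tilde hsI hx)
      have h2 : (algebraMap R K s)⁻¹ ∈ homogeneousQuotientField 𝒜 K :=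
        ⟨1, s, hs, by simp⟩
      convert (homogeneousQuotientField 𝒜 K).mul_mem h2 h1 using 1
      rw [Algebra.smul_def, inv_mul_cancel_left₀ hs0]
  · rintro ⟨hx, a, t, ht, rfl⟩
    have ht0 : algebraMap R K t ≠ 0 := (map_ne_zero_iff _ hinj).2 ht.1
    have hspan : ∀ r ∈ nonzeroHomogeneous 𝒜, (Ideal.span {r}).IsHomogeneous 𝒜 := fun r hr =>
      Ideal.homogeneous_span 𝒜 _ (by simpa using hr.2)
    -- `r (a / t) ∈ I` if and only if `r s a ∈ t J`
    have hmem : ∀ r : R, r • (algebraMap R K a / algebraMap R K t) ∈ I ↔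
        r * (s * a) ∈ Ideal.span {t} * J := by
      intro r
      rw [← smul_mem_smul_iff hs0, hsI, mem_coeSubmodule,
        Ideal.mem_span_singleton_mul]
      refine exists_congr fun z => and_congr_right fun _ => ?_
      rw [← hinj.eq_iff]
      simp only [map_mul, Algebra.smul_def, Algebra.algebraMap_self, RingHom.id_apply]
      constructor
      · intro h
        rw [h]
        field_simp
      · intro h
        field_simp
        linear_combination h
    have htJ : (Ideal.span {t} * J).IsHomogeneous 𝒜 := (hspan t ht).mul hJ
    -- Because `sa ∈ C(sa)`, this colon is a homogeneous ideal inside the ideal of all `r` that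
    -- multiply `a / t` into `I`.
    obtain ⟨L, hL, hle⟩ := exists_isFull_le 𝒜 (star := star) hne
      (I := (Ideal.span {t} * J).colon (compIdeal 𝒜 (s * a) : Set R))
      (isHomogeneous_colon 𝒜 htJ (compIdeal_isHomogeneous 𝒜 _)) fun Q hQ hle => by
        obtain ⟨r, hrQ, hr⟩ := hx Q hQ
        obtain ⟨n, hn⟩ := exists_compIdeal_pow_mul_le 𝒜 htJ ((hmem r).1 hr)
        have hpow : compIdeal 𝒜 r ^ n ≤ Q := by
          refine le_trans (fun y hy => Submodule.mem_colon.2 fun z hz => ?_) hle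
          exact hn (Ideal.mul_mem_mul hy hz)
        exact hrQ ((isPrime_of_mem_hQMax 𝒜 hQ).le_of_pow_le hpow (mem_compIdeal 𝒜 r))
    exact ⟨L, hL, fun r hr => (hmem r).2
      (Submodule.mem_colon.1 (hle hr) _ (mem_compIdeal 𝒜 (s * a)))⟩

end Main

end GradedNagata

/-! ### The main theorem -/

open GradedNagata in
theorem mainTheorem10 {Γ R K : Type*} [AddCancelCommMonoid Γ] [IsAddTorsionFree Γ] [DecidableEq Γ]
    [CommRing R] [IsDomain R] [Field K] [Algebra R K] [IsFractionRing R K]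
    (𝒜 : Γ → AddSubgroup R) [GradedRing 𝒜] (star : SemistarOperation R K)
    (hstar : (star 1 : Set K) ⊂ (homogeneousQuotientField 𝒜 K : Set K)) :
    ∃ hprime : ∀ Q ∈ hQMax 𝒜 star.tilde, Q.IsPrime,
      -- the multiplicative set
      ((nStar 𝒜 star : Set R[X]) =
        (⋃ Q ∈ hQMax 𝒜 star.tilde, (Q.map Polynomial.C : Set R[X]))ᶜ) ∧
      -- the maximal ideals of the Nagata ring
      ({M : Ideal (gradedNagata 𝒜 star) | M.IsMaximal} =
        {M | ∃ Q ∈ hQMax 𝒜 star.tilde, M = Q.map (toGradedNagata 𝒜 star)}) ∧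
      -- the Nagata ring as an intersection
      ((gradedNagata 𝒜 star : Set (RatFunc K)) =
        ⋂ (Q) (hQ : Q ∈ hQMax 𝒜 star.tilde), nagata K (localRing K Q (hprime Q hQ))) ∧
      -- extensions of nonzero submodules of the quotient field
      (∀ I : Submodule R K, I ≠ ⊥ →
        (extend (gradedNagata 𝒜 star) I : Set (RatFunc K)) =
          ⋂ (Q) (hQ : Q ∈ hQMax 𝒜 star.tilde),
            (extend (nagata K (localRing K Q (hprime Q hQ))) I : Set (RatFunc K))) ∧
      (∀ I : Submodule R K, I ≠ ⊥ →
        algebraMap K (RatFunc K) ⁻¹' (extend (gradedNagata 𝒜 star) I : Set (RatFunc K)) =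
          ⋂ (Q) (hQ : Q ∈ hQMax 𝒜 star.tilde),
            (extend (localRing K Q (hprime Q hQ)) I : Set K)) ∧
      -- nonzero homogeneous ideals, integral or fractional
      (∀ I : Submodule R K, I ≠ ⊥ → IsHomogeneousFractional 𝒜 I →
        (star.tilde I : Set K) =
          algebraMap K (RatFunc K) ⁻¹' (extend (gradedNagata 𝒜 star) I : Set (RatFunc K)) ∩
            (homogeneousQuotientField 𝒜 K : Set K)) := by
  have hne := hQMax_nonempty 𝒜 hstar
  refine ⟨fun Q hQ => isPrime_of_mem_hQMax 𝒜 hQ, ?_, ?_, ?_, ?_, ?_, ?_⟩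
  · ext f
    simpa using mem_nStar_iff 𝒜 hne
  · ext M
    exact isMaximal_iff 𝒜 hne M
  · ext u
    simpa only [Set.mem_iInter, SetLike.mem_coe] using mem_gradedNagata_iff 𝒜 hne
  · intro I _
    ext u
    simpa only [Set.mem_iInter, SetLike.mem_coe] using mem_extend_gradedNagata_iff 𝒜 hne
  · intro I _
    ext x
    simpa only [Set.mem_iInter, Set.mem_preimage, SetLike.mem_coe] using
      algebraMap_mem_extend_gradedNagata_iff 𝒜 hne
  · intro I _ hI
    ext x
    exact mem_tilde_iff_of_isHomogeneousFractional 𝒜 hstar hI
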